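/- Let $R$ be a one-dimensional Noetherian complete local domain, and let $R^+$ be its absolute integral closure, i.e. the integral closure of $R$ in an algebraic closure of its field of fractions. Then $R^+$ is a local ring; let $\mathfrak m_{R^+}$ be its maximal ideal. Let $0\neq x\in\mathfrak m_{R^+}$, and let $v\colon R^+\to\mathbb Q\cup\{\infty\}$ be a valuation (so $v(a)=\infty$ only for $a=0$) that is nonnegative on $R^+$ and positive on $\mathfrak m_{R^+}$. Consider the following classes of $R^+$-modules: - $\mathfrak T_v$, the modules $M$ such that for all $m\in M$ and all $\epsilon>0$ there is $a\in R^+$ with $v(a)<\epsilon$ and $am=0$; - $\mathcal{GR}$, the modules $M$ with $\mathfrak m_{R^+}M=0$; - $\mathfrak T_x$, the modules $M$ that are killed by $x^{1/n}$ (an $n$-th root of $x$ in $R^+$, unique up to a unit) for arbitrarily large $n$. Then $\mathfrak T_v=\mathcal{GR}=\mathfrak T_x$. Moreover $\mathrm{cd}(\mathfrak T_v)=2$. Here, for a torsion theory $\mathfrak T$ (a class of modules closed under submodules, quotients, extensions and direct limits of directed systems), $\mathrm{cd}(\mathfrak T)$ denotes the largest integer $i$ such that the $i$-th right derived functor of the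 left exact functor sending $M$ to its largest submodule that belongs to $\mathfrak T$ is nonzero. -/

import Mathlib

open CategoryTheory CategoryTheory.Limits

universe u

/-- The absolute integral closure `R⁺` of a domain `R`: the integral closure of `R` inside an
algebraic closure of its field of fractions. -/
abbrev AbsIntClosure (R : Type u) [CommRing R] [IsDomain R] : Type u :=
  integralClosure R (AlgebraicClosure (FractionRing R))

section TorsionTheories

variable {A : Type u} [CommRing A]

/-- A torsion theory of `A`-modules: a Serre class (closed under submodules, quotients and
extensions) that is also closed under the direct limits of directed systems of its objects. -/
class IsTorsionTheory (T : ObjectProperty (ModuleCat.{u} A)) : Prop extends T.IsSerreClass where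
  closedUnderDirectLimits : ∀ (J : Type u) [Preorder J] [Nonempty J] [IsDirectedOrder J],
    T.IsClosedUnderColimitsOfShape J

/-- The largest submodule `t(M)` of `M` that belongs to the torsion theory `T`, as the supremum of
all the submodules of `M` that belong to `T`. -/
def torsionPart (T : ObjectProperty (ModuleCat.{u} A)) (M : ModuleCat.{u} A) : Submodule A M :=
  sSup {N : Submodule A M | T (ModuleCat.of A N)}

lemma torsionPart_le_comap (T : ObjectProperty (ModuleCat.{u} A)) [T.IsClosedUnderQuotients]
    {M N : ModuleCat.{u} A} (f : M ⟶ N) :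
    torsionPart T M ≤ (torsionPart T N).comap f.hom := by
  refine sSup_le fun K hK => ?_
  rw [← Submodule.map_le_iff_le_comap]
  refine le_sSup ?_
  have : Epi (ModuleCat.ofHom (f.hom.submoduleMap K)) :=
    (ModuleCat.epi_iff_surjective _).2 (f.hom.submoduleMap_surjective K)
  exact T.prop_of_epi (ModuleCat.ofHom (f.hom.submoduleMap K)) hK

/-- The functor `M ↦ t(M)` on `A`-modules that is given by a torsion theory. -/
def torsionFunctor (T : ObjectProperty (ModuleCat.{u} A)) [IsTorsionTheory T] :
    ModuleCat.{u} A ⥤ ModuleCat.{u} A where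
  obj M := ModuleCat.of A (torsionPart T M)
  map f := ModuleCat.ofHom (f.hom.restrict (torsionPart_le_comap T f))

instance torsionFunctor_additive (T : ObjectProperty (ModuleCat.{u} A)) [IsTorsionTheory T] :
    (torsionFunctor T).Additive where
  map_add := rfl

/-- The cohomological dimension of the torsion theory `T` is `n`: the integer `n` is the largest
`i` such that the `i`-th right derived functor of `M ↦ t(M)` is nonzero. -/
def CohomologicalDimensionEq (T : ObjectProperty (ModuleCat.{u} A)) [IsTorsionTheory T]
    (n : ℕ) : Prop :=
  IsGreatest {i : ℕ | ¬ IsZero ((torsionFunctor T).rightDerived i)} n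

end TorsionTheories

section AlmostZero

variable {A : Type u} [CommRing A]

/-- The class `𝔗_v` of the modules that are almost zero with respect to a valuation `v`: every
element is killed by ring elements of arbitrarily small value. -/
def AlmostZeroVal (v : AddValuation A (WithTop ℚ)) : ObjectProperty (ModuleCat.{u} A) :=
  fun M => ∀ m : M, ∀ ε : ℚ, 0 < ε → ∃ a : A, v a < (ε : WithTop ℚ) ∧ a • m = 0

/-- The class `𝒢ℛ` of the modules that are killed by the maximal ideal of the local ring `A`. -/
def AlmostZeroMax (A : Type u) [CommRing A] [IsLocalRing A] : ObjectProperty (ModuleCat.{u} A) :=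
  fun M => IsLocalRing.maximalIdeal A • (⊤ : Submodule A M) = ⊥

/-- The class `𝔗_x` of the modules that are killed by `x^{1/n}` for arbitrarily large `n`, where
`x^{1/n}` is an `n`-th root of `x` in `A`. In an absolute integral closure the `n`-th roots of `x`
are unit multiples of each other, so it does not matter which of them is taken. -/
def AlmostZeroElt (x : A) : ObjectProperty (ModuleCat.{u} A) :=
  fun M => ∀ N : ℕ, ∃ n : ℕ, N ≤ n ∧ 0 < n ∧ ∃ y : A, y ^ n = x ∧ ∀ m : M, y • m = 0

instance almostZeroVal_isTorsionTheory (v : AddValuation A (WithTop ℚ)) :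
    IsTorsionTheory (AlmostZeroVal v) where
  exists_zero := by
    refine ⟨ModuleCat.of A PUnit, ModuleCat.isZero_of_subsingleton _, fun m ε hε => ⟨1, ?_, ?_⟩⟩
    · rw [v.map_one]
      exact_mod_cast hε
    · exact Subsingleton.elim _ _
  prop_of_mono := by
    intro X Y f hf hY m ε hε
    obtain ⟨a, ha, h⟩ := hY (f.hom m) ε hε
    refine ⟨a, ha, (ModuleCat.mono_iff_injective f).1 hf ?_⟩
    change f.hom (a • m) = f.hom 0
    rw [map_smul, h, map_zero]
  prop_of_epi := by
    intro X Y f hf hX m ε hε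
    obtain ⟨x, rfl⟩ := (ModuleCat.epi_iff_surjective f).1 hf m
    obtain ⟨a, ha, h⟩ := hX x ε hε
    refine ⟨a, ha, ?_⟩
    change a • f.hom x = 0
    rw [← map_smul, h, map_zero]
  prop_X₂_of_shortExact := by
    intro S hS h₁ h₃ m ε hε
    obtain ⟨a, ha, h⟩ := h₃ (S.g.hom m) (ε / 2) (half_pos hε)
    rw [← map_smul] at h
    obtain ⟨x, hx⟩ := (ShortComplex.moduleCat_exact_iff S).1 hS.exact _ h
    obtain ⟨b, hb, h'⟩ := h₁ x (ε / 2) (half_pos hε)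
    refine ⟨b * a, ?_, ?_⟩
    · rw [v.map_mul]
      have hsum : (ε : WithTop ℚ) = ((ε / 2 : ℚ) : WithTop ℚ) + ((ε / 2 : ℚ) : WithTop ℚ) := by
        rw [← WithTop.coe_add, add_halves]
      rw [hsum]
      exact WithTop.add_lt_add hb ha
    · change S.f.hom x = a • m at hx
      rw [mul_smul, ← hx, ← map_smul, h', map_zero]
  closedUnderDirectLimits := by
    intro J _ _ _
    refine ⟨?_⟩
    rintro M ⟨c⟩ m ε hε
    obtain ⟨j, x, rfl⟩ := Concrete.isColimit_exists_rep c.diag c.isColimit m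
    obtain ⟨a, ha, h⟩ := c.prop_diag_obj j x ε hε
    refine ⟨a, ha, ?_⟩
    change a • (c.ι.app j).hom x = 0
    rw [← map_smul, h, map_zero]

end AlmostZero

/-! Everything rests on `R⁺` being a valuation ring of dimension one. It is local because
idempotents lift along a complete ideal, so finite domain extensions of `R` are local. It is a
valuation ring by the Krull-Akizuki length bound: `a / b` is a root of a polynomial with a unit
coefficient, and integral closedness then puts `a / b` or its inverse in `R⁺`
(`dvd_or_dvd_of_isIntegral`). By the dimension, roots of `x` of high order divide any given element
of the maximal ideal `𝔪`. So these roots generate `𝔪`, and the three classes agree. For the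
dimension, `t(M) = Hom(R⁺/𝔪, M)`, with derived functors `Ext^i(R⁺/𝔪, M)`. Here `𝔪` is the increasing
union of the free ideals `(t n)`, `t n = x^(1/2^n)`, so it has projective dimension at most 1 and
`Ext^i` vanishes for `i ≥ 3`. Moreover `Ext²(R⁺/𝔪, M) = Ext¹(𝔪, M)` is a `lim¹` of copies of `M`,
nonzero for `M` free of countable rank. Both facts are proved by chasing elements in an injective
resolution. -/

/-! ### Inverse sequences of multiplication maps: `lim` and `lim¹` -/

section InjectiveModules

variable {A : Type u} [CommRing A]

/-- A compatible system of equations `t i • w = u i` is solvable in an injective module. -/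
lemma Module.Injective.exists_smul_eq {I : Type u} [AddCommGroup I] [Module A I]
    [Module.Injective A I] {ι : Type} (t : ι → A) (y : ι → I)
    (h : ∀ c : ι →₀ A, Finsupp.linearCombination A t c = 0 →
      Finsupp.linearCombination A y c = 0) :
    ∃ w : I, ∀ i, t i • w = y i := by
  let f := Finsupp.linearCombination A t
  let g := Finsupp.linearCombination A y
  have hle : LinearMap.ker f ≤ LinearMap.ker g := fun c hc => h c hc
  -- The quotient by `ker f` is the ideal generated by the `t i`. The map `t i ↦ y i` on it extends
  -- to the ring, and `w` is the value at 1.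
  have hinj : Function.Injective ((LinearMap.ker f).liftQ f le_rfl) :=
    LinearMap.ker_eq_bot.1 (Submodule.ker_liftQ_eq_bot _ _ _ le_rfl)
  obtain ⟨φ, hφ⟩ := Module.Injective.out ((LinearMap.ker f).liftQ f le_rfl) hinj
    ((LinearMap.ker f).liftQ g hle)
  refine ⟨φ 1, fun i => ?_⟩
  have := hφ (Submodule.Quotient.mk (Finsupp.single i 1))
  rw [← map_smul, smul_eq_mul, mul_one]
  simpa [f, g] using this

/-- The map `e n ↦ e n - s (n - 1) • e (n - 1)` dual to `c ↦ (c n - s n • c (n + 1))`. -/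
lemma linearCombination_single_sub_injective (s : ℕ → A) :
    Function.Injective (Finsupp.linearCombination A fun n : ℕ =>
      (Finsupp.single n 1 - Finsupp.single (n + 1) (s n) : ℕ →₀ A)) := by
  rw [injective_iff_map_eq_zero]
  intro c hc
  have key : ∀ k, (Finsupp.linearCombination A fun n : ℕ =>
      (Finsupp.single n 1 - Finsupp.single (n + 1) (s n) : ℕ →₀ A)) c k =
      c k - ∑ i ∈ c.support, (if i + 1 = k then c i * s i else 0) := by
    intro k
    rw [Finsupp.linearCombination_apply, Finsupp.sum, Finsupp.finsetSum_apply]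
    simp only [Finsupp.smul_apply, Finsupp.sub_apply, smul_eq_mul, mul_sub,
      Finset.sum_sub_distrib, Finsupp.single_apply, mul_ite, mul_one, mul_zero]
    congr 1
    simp
  -- Coordinate 0 of the image is `c 0` and coordinate `k + 1` is `c (k + 1) - c k * s k`.
  ext k
  induction k with
  | zero => simpa [hc, eq_comm] using key 0
  | succ k ih =>
    have h := key (k + 1)
    rw [hc, Finset.sum_eq_zero] at h
    · simpa [eq_comm] using h
    · intro i _
      split_ifs with hi
      · obtain rfl : i = k := by omega
        rw [ih]
        simp
      · rfl

/-- In an injective module, `lim¹` of a sequence of multiplication maps vanishes. -/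
lemma Module.Injective.exists_sub_smul_succ_eq {I : Type u} [AddCommGroup I] [Module A I]
    [Module.Injective A I] (s : ℕ → A) (e : ℕ → I) :
    ∃ c : ℕ → I, ∀ n, c n - s n • c (n + 1) = e n := by
  obtain ⟨φ, hφ⟩ := Module.Injective.out _ (linearCombination_single_sub_injective s)
    (Finsupp.linearCombination A e)
  refine ⟨fun n => φ (Finsupp.single n 1), fun n => ?_⟩
  have := hφ (Finsupp.single n 1)
  rw [← map_smul, ← map_sub]
  simpa using this

lemma eq_prod_smul_of_eq_smul_succ {M : Type*} [AddCommGroup M] [Module A M] {s : ℕ → A}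
    {y : ℕ → M} (hy : ∀ n, y n = s n • y (n + 1)) {m n : ℕ} (h : m ≤ n) :
    y m = (∏ i ∈ Finset.Ico m n, s i) • y n := by
  induction n, h using Nat.le_induction with
  | base => simp
  | succ n hmn ih => rw [ih, hy n, Finset.prod_Ico_succ_top hmn, mul_smul]

/-- An element of `lim Hom((t n), I)` extends from `⋃ (t n)` to the ring. -/
lemma Module.Injective.exists_smul_eq_of_eq_smul_succ [IsDomain A] {I : Type u} [AddCommGroup I]
    [Module A I] [Module.Injective A I] {s t : ℕ → A} (ht0 : ∀ n, t n ≠ 0)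
    (hts : ∀ n, t n = s n • t (n + 1)) {y : ℕ → I} (hy : ∀ n, y n = s n • y (n + 1)) :
    ∃ w : I, ∀ n, t n • w = y n := by
  refine Module.Injective.exists_smul_eq t y fun c hc => ?_
  obtain ⟨N, hN⟩ : ∃ N, ∀ i ∈ c.support, i ≤ N :=
    ⟨c.support.sup id, fun i hi => Finset.le_sup (f := id) hi⟩
  -- Every term is pushed to the single index `N`; the same scalar then multiplies `t N` and `y N`,
  -- and it vanishes since `t N ≠ 0`.
  have key : ∀ {M : Type u} [AddCommGroup M] [Module A M] (z : ℕ → M),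
      (∀ n, z n = s n • z (n + 1)) → Finsupp.linearCombination A z c =
        (∑ i ∈ c.support, c i * ∏ j ∈ Finset.Ico i N, s j) • z N := by
    intro M _ _ z hz
    rw [Finsupp.linearCombination_apply, Finsupp.sum, Finset.sum_smul]
    refine Finset.sum_congr rfl fun i hi => ?_
    rw [mul_smul, ← eq_prod_smul_of_eq_smul_succ hz (hN i hi)]
  rw [key t hts, smul_eq_mul] at hc
  rw [key y hy, (mul_eq_zero.1 hc).resolve_right (ht0 N), zero_smul]

/-- In a free module of countable rank, `lim¹` of a sequence of multiplications by non-units does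
not vanish. -/
lemma not_exists_sub_smul_succ_eq_single [IsDomain A] {s : ℕ → A} (hs0 : ∀ n, s n ≠ 0)
    (hs : ∀ n, ¬ IsUnit (s n)) :
    ¬ ∃ c : ℕ → (ℕ →₀ A), ∀ n, c n - s n • c (n + 1) = Finsupp.single n 1 := by
  rintro ⟨c, hc⟩
  have h : ∀ n k, c n k = (if n = k then 1 else 0) + s n * c (n + 1) k := by
    intro n k
    have := DFunLike.congr_fun (hc n) k
    rw [Finsupp.sub_apply, Finsupp.smul_apply, smul_eq_mul, Finsupp.single_apply] at this
    rw [← this, sub_add_cancel]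
  have hdiag : ∀ n, c n n ≠ 0 := by
    intro n hn
    rw [h, if_pos rfl] at hn
    exact hs n (IsUnit.of_mul_eq_one (-c (n + 1) n) (by linear_combination -hn))
  -- Off the diagonal `c n k = s n * c (n + 1) k`, so nonvanishing descends from `c k k` to `c 0 k`,
  -- for every `k`.
  have hne : ∀ k n, n ≤ k → c n k ≠ 0 := by
    intro k n hnk
    induction hnk using Nat.decreasingInduction with
    | self => exact hdiag k
    | of_succ n hn ih =>
      rw [h, if_neg (Nat.ne_of_lt hn), zero_add]
      exact mul_ne_zero (hs0 n) ih
  exact Set.infinite_univ ((c 0).hasFiniteSupport.subset fun k _ => hne k 0 (Nat.zero_le k))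

end InjectiveModules

/-! ### Derived functors of the torsion functor -/

section Cohomology

variable {A : Type u} [CommRing A] (T : ObjectProperty (ModuleCat.{u} A)) [IsTorsionTheory T]

instance injective_cocomplex_X {M : ModuleCat.{u} A} (I : InjectiveResolution M) (n : ℕ) :
    Module.Injective A (I.cocomplex.X n) :=
  have : Injective (ModuleCat.of A (I.cocomplex.X n)) := I.injective n
  Module.injective_module_of_injective_object A _

lemma InjectiveResolution.exists_d_eq {M : ModuleCat.{u} A} (I : InjectiveResolution M) (n : ℕ)
    (z : I.cocomplex.X (n + 1)) (hz : (I.cocomplex.d (n + 1) (n + 2)).hom z = 0) :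
    ∃ w : I.cocomplex.X n, (I.cocomplex.d n (n + 1)).hom w = z :=
  (ShortComplex.moduleCat_exact_iff _).1 (I.exact_succ n) z hz

lemma InjectiveResolution.d_d_apply {M : ModuleCat.{u} A} (I : InjectiveResolution M) (n : ℕ)
    (z : I.cocomplex.X n) :
    (I.cocomplex.d (n + 1) (n + 2)).hom ((I.cocomplex.d n (n + 1)).hom z) = 0 := by
  rw [← ModuleCat.comp_apply, I.complex_d_comp]
  rfl

/-- The vanishing of a derived functor of `M ↦ t(M)` in terms of elements of a resolution. -/
lemma isZero_rightDerived_torsionFunctor_iff {M : ModuleCat.{u} A} (I : InjectiveResolution M)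
    (n : ℕ) :
    IsZero (((torsionFunctor T).rightDerived (n + 1)).obj M) ↔
      ∀ z ∈ torsionPart T (I.cocomplex.X (n + 1)),
        (I.cocomplex.d (n + 1) (n + 2)).hom z = 0 →
        ∃ w ∈ torsionPart T (I.cocomplex.X n), (I.cocomplex.d n (n + 1)).hom w = z := by
  rw [(I.isoRightDerivedObj (torsionFunctor T) (n + 1)).isZero_iff]
  change IsZero ((((torsionFunctor T).mapHomologicalComplex _).obj I.cocomplex).homology (n + 1)) ↔ _
  rw [← HomologicalComplex.exactAt_iff_isZero_homology,
    HomologicalComplex.exactAt_iff' _ n (n + 1) (n + 2) (by simp)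
      (by simp only [CochainComplex.next]; rfl), ShortComplex.moduleCat_exact_iff]
  constructor
  · intro h z hz hdz
    obtain ⟨w, hw⟩ := h ⟨z, hz⟩ (Subtype.ext hdz)
    exact ⟨w.1, w.2, congrArg Subtype.val hw⟩
  · rintro h ⟨z, hz⟩ hdz
    obtain ⟨w, hw, hdw⟩ := h z hz (congrArg Subtype.val hdz)
    exact ⟨⟨w, hw⟩, Subtype.ext hdw⟩

variable {T} [IsDomain A] {s t : ℕ → A} (ht0 : ∀ n, t n ≠ 0) (hts : ∀ n, t n = s n • t (n + 1))
  (hT : ∀ (M : ModuleCat.{u} A) (m : M), m ∈ torsionPart T M ↔ ∀ n, t n • m = 0)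

-- This is `lim¹ = 0` on injectives. A torsion cocycle `z = d w` gives `t n • w = d (y n)`, and the
-- defects `y n - s n • y (n + 1)` are boundaries of elements `e n`. This last step uses exactness
-- in degree `j + 1`, hence the start at 3. Correcting the `y n` makes them compatible, so they come
-- from one `q`, and `w - d q` is torsion.
include ht0 hts hT in
lemma isZero_rightDerived_torsionFunctor_add_three (j : ℕ) :
    IsZero ((torsionFunctor T).rightDerived (j + 3)) := by
  rw [Functor.isZero_iff]
  intro M
  let I := (HasInjectiveResolution.out (Z := M)).some
  rw [isZero_rightDerived_torsionFunctor_iff T I (j + 2)]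
  intro z hz hdz
  rw [hT] at hz
  obtain ⟨w, rfl⟩ := InjectiveResolution.exists_d_eq I _ z hdz
  have h1 : ∀ n, ∃ y, (I.cocomplex.d (j + 1) (j + 2)).hom y = t n • w := fun n =>
    InjectiveResolution.exists_d_eq I _ _ (by rw [map_smul, hz])
  choose y hy using h1
  have h2 : ∀ n, ∃ e, (I.cocomplex.d j (j + 1)).hom e = y n - s n • y (n + 1) := fun n =>
    InjectiveResolution.exists_d_eq I _ _ (by
      rw [map_sub, map_smul, hy, hy, hts n, smul_assoc, sub_self])
  choose e he using h2
  obtain ⟨c, hc⟩ := Module.Injective.exists_sub_smul_succ_eq s e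
  obtain ⟨q, hq⟩ := Module.Injective.exists_smul_eq_of_eq_smul_succ ht0 hts
    (y := fun n => y n - (I.cocomplex.d j (j + 1)).hom (c n)) fun n => by
      have := he n
      rw [← hc n, map_sub, map_smul] at this
      rw [smul_sub, sub_eq_sub_iff_sub_eq_sub, ← this]
  refine ⟨w - (I.cocomplex.d (j + 1) (j + 2)).hom q, (hT _ _).2 fun n => ?_, ?_⟩
  · rw [smul_sub, ← map_smul, hq, map_sub, hy, InjectiveResolution.d_d_apply, sub_zero, sub_self]
  · rw [map_sub, InjectiveResolution.d_d_apply, sub_zero]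

-- In degree 2 the defects live in `M` itself, which need not be injective, so the obstruction is
-- `lim¹` of `M`. A sequence in `M = A^(ℕ)` that is not a `lim¹` boundary becomes one in `X 0`, and
-- this yields a torsion cocycle `d w`.
include ht0 hts hT in
lemma not_isZero_rightDerived_torsionFunctor_two (hs : ∀ n, ¬ IsUnit (s n)) :
    ¬ IsZero ((torsionFunctor T).rightDerived 2) := by
  intro hzero
  rw [Functor.isZero_iff] at hzero
  let M := ModuleCat.of A (ℕ →₀ A)
  let I := (HasInjectiveResolution.out (Z := M)).some
  have h := (isZero_rightDerived_torsionFunctor_iff T I 1).1 (hzero M)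
  let ε : M →ₗ[A] I.cocomplex.X 0 := (I.ι.f 0).hom
  have hε : Function.Injective ε := (ModuleCat.mono_iff_injective (I.ι.f 0)).1 inferInstance
  have hdε : ∀ m, (I.cocomplex.d 0 1).hom (ε m) = 0 := fun m => by
    change (I.ι.f 0 ≫ I.cocomplex.d 0 1).hom m = 0
    rw [I.ι_f_zero_comp_complex_d]
    rfl
  have hex : ∀ y, (I.cocomplex.d 0 1).hom y = 0 → ∃ m : M, ε m = y :=
    (ShortComplex.moduleCat_exact_iff _).1 I.exact₀
  let b : ℕ → M := fun n => (Finsupp.single n 1 : ℕ →₀ A)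
  obtain ⟨y, hy⟩ := Module.Injective.exists_sub_smul_succ_eq s fun n => ε (b n)
  obtain ⟨w, hw⟩ := Module.Injective.exists_smul_eq_of_eq_smul_succ ht0 hts
    (y := fun n => (I.cocomplex.d 0 1).hom (y n)) fun n => by
      rw [← map_smul, ← sub_eq_zero, ← map_sub, hy, hdε]
  obtain ⟨w', hw', hdw'⟩ := h ((I.cocomplex.d 1 2).hom w)
    ((hT _ _).2 fun n => by rw [← map_smul, hw, InjectiveResolution.d_d_apply])
    (InjectiveResolution.d_d_apply I _ _)
  rw [hT] at hw'
  obtain ⟨q, hq⟩ := InjectiveResolution.exists_d_eq I 0 (w - w') (by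
    rw [map_sub, sub_eq_zero, hdw'])
  -- Subtracting `t n • q` keeps the differences `y n - s n • y (n + 1)` and brings the solution
  -- back into `M`.
  have h3 : ∀ n, ∃ c, ε c = y n - t n • q := fun n => hex _ (by
    rw [map_sub, map_smul, hq, smul_sub, hw, hw', sub_zero, sub_self])
  choose c hc using h3
  refine not_exists_sub_smul_succ_eq_single (s := s) (fun n hn => ht0 n ?_) hs ⟨c, fun n => hε ?_⟩
  · rw [hts, hn, zero_smul]
  · change ε (c n - s n • c (n + 1)) = ε (b n)
    rw [map_sub, map_smul, hc, hc, ← hy, hts n, smul_assoc, smul_sub]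
    abel

include ht0 hts hT in
theorem cohomologicalDimensionEq_two (hs : ∀ n, ¬ IsUnit (s n)) :
    CohomologicalDimensionEq T 2 := by
  refine ⟨not_isZero_rightDerived_torsionFunctor_two ht0 hts hT hs, fun i hi => ?_⟩
  by_contra! hlt
  obtain ⟨j, rfl⟩ := Nat.exists_eq_add_of_le' (show 3 ≤ i from hlt)
  exact hi (isZero_rightDerived_torsionFunctor_add_three ht0 hts hT j)

end Cohomology

/-! ### Locality of integral extensions of a complete local ring -/

section Local

/-- A module-finite module over an adically complete Noetherian local ring is complete. -/
lemma IsAdicComplete.of_finite {R : Type*} [CommRing R] (I : Ideal R) [IsAdicComplete I R]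
    (M : Type*) [AddCommGroup M] [Module R M] [Module.Finite R M] [IsHausdorff I M] :
    IsAdicComplete I M where
  toIsPrecomplete := by
    rw [← AdicCompletion.of_surjective_iff]
    intro y
    obtain ⟨z, rfl⟩ := AdicCompletion.ofTensorProduct_surjective_of_finite I M y
    induction z using TensorProduct.induction_on with
    | zero => exact ⟨0, by simp⟩
    | tmul r x =>
      obtain ⟨r, rfl⟩ := AdicCompletion.of_surjective I R r
      refine ⟨r • x, ?_⟩
      rw [AdicCompletion.ofTensorProduct_tmul, map_smul]
      ext n
      simp
      rfl
    | add z₁ z₂ h₁ h₂ =>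
      obtain ⟨x₁, h₁⟩ := h₁
      obtain ⟨x₂, h₂⟩ := h₂
      exact ⟨x₁ + x₂, by rw [map_add, map_add, h₁, h₂]⟩

/-- An Artinian ring with only trivial idempotents is local. -/
lemma isUnit_or_isUnit_one_sub_of_isArtinianRing {C : Type*} [CommRing C] [IsArtinianRing C]
    (hC : ∀ e : C, e * e = e → e = 0 ∨ e = 1) (a : C) : IsUnit a ∨ IsUnit (1 - a) := by
  obtain ⟨n, y, hy⟩ := IsArtinian.exists_pow_succ_smul_dvd a (1 : C)
  simp only [smul_eq_mul, mul_one, Nat.succ_eq_add_one] at hy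
  have hpow : ∀ k, a ^ n = a ^ (n + k) * y ^ k := by
    intro k
    induction k with
    | zero => simp
    | succ k ih =>
      calc a ^ n = a ^ n * (a ^ k * y ^ k) := by rw [← mul_assoc, ← pow_add, ← ih]
        _ = (a ^ (n + 1) * y) * (a ^ k * y ^ k) := by rw [hy]
        _ = _ := by ring
  -- Stabilization of the powers of `a` makes `a ^ n * y ^ n` idempotent; it is 0 when `a` is
  -- nilpotent and 1 when `a` is a unit.
  obtain h | h := hC (a ^ n * y ^ n) (by
    calc a ^ n * y ^ n * (a ^ n * y ^ n) = (a ^ (n + n) * y ^ n) * y ^ n := by ring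
      _ = _ := by rw [← hpow])
  · right
    have : a ^ n = 0 := by
      rw [hpow n, pow_add, mul_assoc, h, mul_zero]
    exact IsNilpotent.isUnit_one_sub ⟨n, this⟩
  · left
    rcases n with _ | n
    · exact IsUnit.of_mul_eq_one y (by simpa using hy)
    · exact IsUnit.of_mul_eq_one (a ^ n * y ^ (n + 1)) (by rw [← h]; ring)

/-- A finite domain extension of a complete Noetherian local ring is local. -/
lemma IsLocalRing.of_finite_of_isAdicComplete (R : Type*) [CommRing R] [IsNoetherianRing R]
    [IsLocalRing R] [IsAdicComplete (IsLocalRing.maximalIdeal R) R] (B : Type*) [CommRing B]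
    [IsDomain B] [Algebra R B] [Module.Finite R B] : IsLocalRing B := by
  refine .of_isUnit_or_isUnit_one_sub_self fun a => ?_
  let J := (IsLocalRing.maximalIdeal R).map (algebraMap R B)
  have hc : IsAdicComplete (IsLocalRing.maximalIdeal R) B := IsAdicComplete.of_finite _ _
  have hJ : IsAdicComplete J B := (IsAdicComplete.map_algebraMap_iff _ _).2 hc
  have hjac : J ≤ (⊥ : Ideal B).jacobson := IsAdicComplete.le_jacobson_bot J
  let _ : Field (R ⧸ IsLocalRing.maximalIdeal R) := Ideal.Quotient.field _
  have hart : IsArtinianRing (B ⧸ J) := by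
    have hmap : IsLocalRing.maximalIdeal R ≤ J.comap (algebraMap R B) := Ideal.le_comap_map
    let _ : Algebra (R ⧸ IsLocalRing.maximalIdeal R) (B ⧸ J) :=
      (Ideal.quotientMap J (algebraMap R B) hmap).toAlgebra
    have : IsScalarTower R (R ⧸ IsLocalRing.maximalIdeal R) (B ⧸ J) :=
      IsScalarTower.of_algebraMap_eq' rfl
    have : Module.Finite (R ⧸ IsLocalRing.maximalIdeal R) (B ⧸ J) :=
      Module.Finite.of_restrictScalars_finite R _ _
    exact IsArtinianRing.of_finite (R ⧸ IsLocalRing.maximalIdeal R) (B ⧸ J)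
  have hunit : ∀ b : B, IsUnit (Ideal.Quotient.mk J b) → IsUnit b := fun b hb => by
    have := isLocalHom_of_le_jacobson_bot J hjac
    exact isUnit_of_map_unit _ _ hb
  have hidem : ∀ e : B ⧸ J, e * e = e → e = 0 ∨ e = 1 := by
    intro e he
    obtain ⟨b, rfl⟩ := Ideal.Quotient.mk_surjective e
    -- The idempotent lifts to a root of `X ^ 2 - X` in the domain `B`. The derivative is a unit
    -- there because `(2e - 1)² = 1`.
    obtain ⟨r, hr, hrb⟩ := HenselianRing.is_henselian (I := J)
      (Polynomial.X ^ 2 - Polynomial.X : Polynomial B) (by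
        apply Polynomial.monic_X_pow_sub
        simp) b (by
        rw [← Ideal.Quotient.eq_zero_iff_mem]
        simp [sq, he]) (by
        have hd : (Polynomial.X ^ 2 - Polynomial.X : Polynomial B).derivative.eval b =
            2 * b - 1 := by
          simp [one_add_one_eq_two]
        rw [hd, map_sub, map_mul, map_ofNat, map_one]
        refine IsUnit.of_mul_eq_one (2 * Ideal.Quotient.mk J b - 1) ?_
        linear_combination 4 * he)
    rw [← Ideal.Quotient.eq] at hrb
    rw [← hrb]
    have : r * (r - 1) = 0 := by
      rw [Polynomial.IsRoot.def] at hr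
      simp at hr
      linear_combination hr
    obtain h | h := mul_eq_zero.1 this
    · left
      rw [h, map_zero]
    · right
      rw [sub_eq_zero.1 h, map_one]
  obtain h | h := isUnit_or_isUnit_one_sub_of_isArtinianRing hidem (Ideal.Quotient.mk J a)
  · exact Or.inl (hunit _ h)
  · exact Or.inr (hunit _ (by rwa [map_sub, map_one]))

/-- A domain that is integral over a complete Noetherian local ring is local. -/
lemma IsLocalRing.of_isIntegral_of_isAdicComplete (R : Type*) [CommRing R] [IsNoetherianRing R]
    [IsLocalRing R] [IsAdicComplete (IsLocalRing.maximalIdeal R) R] (B : Type*) [CommRing B]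
    [IsDomain B] [Algebra R B] [Algebra.IsIntegral R B] : IsLocalRing B := by
  refine .of_isUnit_or_isUnit_one_sub_self fun a => ?_
  let S := Algebra.adjoin R {a}
  have : Module.Finite R S :=
    ⟨(Submodule.fg_top _).2 (Algebra.IsIntegral.isIntegral a).fg_adjoin_singleton⟩
  have := IsLocalRing.of_finite_of_isAdicComplete R S
  let a' : S := ⟨a, Algebra.subset_adjoin rfl⟩
  exact (IsLocalRing.isUnit_or_isUnit_one_sub_self a').imp (fun h => h.map S.val)
    fun h => by simpa using! h.map S.val

end Local

/-! ### The valuation property, after Krull and Akizuki -/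

section Valuation

open Polynomial in
/-- In an integrally closed local domain, a root in the fraction field of a polynomial with a
unit coefficient is integral or has an integral inverse. -/
lemma mem_range_or_inv_mem_range_of_isUnit_coeff {A K : Type*} [CommRing A] [IsLocalRing A]
    [IsDomain A] [IsIntegrallyClosed A] [Field K] [Algebra A K] [IsFractionRing A K] (f : K)
    (n : ℕ) (p : A[X]) (hn : p.natDegree ≤ n) (hp : aeval f p = 0)
    (hu : ∃ j, IsUnit (p.coeff j)) :
    f ∈ (algebraMap A K).range ∨ f⁻¹ ∈ (algebraMap A K).range := by
  induction n generalizing p with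
  | zero =>
    obtain ⟨j, hj⟩ := hu
    rw [eq_C_of_natDegree_le_zero hn] at hp hj
    rw [aeval_C, FaithfulSMul.algebraMap_eq_zero_iff] at hp
    rw [hp, map_zero, coeff_zero] at hj
    exact (not_isUnit_zero hj).elim
  | succ n ih =>
    by_cases hd : p.natDegree ≤ n
    · exact ih p hd hp hu
    have hd : p.natDegree = n + 1 := by omega
    -- The product `g` of the leading coefficient and `f` is integral. If neither factor test below
    -- finds a unit, `g * f ^ n` replaces the leading term. This lowers the degree, and a unit
    -- coefficient survives since `g` is in the maximal ideal.
    obtain ⟨g, hg⟩ := IsIntegrallyClosed.isIntegral_iff.1 (isIntegral_leadingCoeff_smul p f hp)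
    rw [Algebra.smul_def] at hg
    by_cases hc : IsUnit p.leadingCoeff
    · left
      obtain ⟨c, hc⟩ := hc
      refine ⟨↑c⁻¹ * g, ?_⟩
      rw [map_mul, hg, ← hc, ← mul_assoc, ← map_mul, Units.inv_mul, map_one, one_mul]
    by_cases hgu : IsUnit g
    · right
      obtain ⟨g, rfl⟩ := hgu
      refine ⟨p.leadingCoeff * ↑g⁻¹, ?_⟩
      refine eq_inv_of_mul_eq_one_left ?_
      rw [map_mul, mul_right_comm, ← hg, ← map_mul, Units.mul_inv, map_one]
    refine ih (p.eraseLead + monomial n g) ?_ ?_ ?_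
    · refine natDegree_add_le_of_degree_le ?_ (natDegree_monomial_le _)
      have := p.eraseLead_natDegree_le
      omega
    · rw [← p.eraseLead_add_monomial_natDegree_leadingCoeff, map_add, aeval_monomial, hd,
        pow_succ'] at hp
      rw [map_add, aeval_monomial, hg, mul_assoc, hp]
    · obtain ⟨j, hj⟩ := hu
      have hjn : j ≠ p.natDegree := by
        rintro rfl
        exact hc hj
      refine ⟨j, ?_⟩
      rw [coeff_add, eraseLead_coeff_of_ne _ hjn, coeff_monomial]
      split_ifs
      · by_contra hcon
        have h1 : p.coeff j + g ∈ IsLocalRing.maximalIdeal A := hcon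
        have h2 : g ∈ IsLocalRing.maximalIdeal A := hgu
        exact (IsLocalRing.mem_maximalIdeal _).1 ((Ideal.add_mem_iff_left _ h2).1 h1) hj
      · rwa [add_zero]

open Pointwise in
/-- Key inequality of the Krull-Akizuki theorem. -/
lemma length_quotient_smul_le {S : Type*} [CommRing S] [IsDomain S] [IsNoetherianRing S]
    [Ring.DimensionLEOne S] {x : S} (hx : x ≠ 0) (J : Ideal S) :
    Module.length S (J ⧸ (Ideal.span {x} • ⊤ : Submodule S J)) ≤
      Module.length S (S ⧸ Ideal.span {x}) := by
  obtain rfl | ⟨y, hyJ, hy0⟩ : J = ⊥ ∨ ∃ y ∈ J, y ≠ 0 := by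
    rw [or_iff_not_imp_left]
    exact Submodule.exists_mem_ne_zero_of_ne_bot
  · rw [Module.length_eq_zero]
    exact zero_le
  -- `S / xJ` has length `ℓ(S/J) + ℓ(S/x)` and also `ℓ(J/xJ) + ℓ(S/J)`; finiteness allows cancelling
  -- `ℓ(S/J)`.
  have hfin : Module.length S (S ⧸ J) ≠ ⊤ := by
    refine ne_top_of_le_ne_top (Module.length_ne_top_iff.2
      (isFiniteLength_quotient_span_singleton S (mem_nonZeroDivisors_of_ne_zero hy0))) ?_
    exact Module.length_le_of_surjective
      (Submodule.factor ((Ideal.span_singleton_le_iff_mem J).2 hyJ)) (Submodule.factor_surjective _)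
  have h1 := Module.length_eq_add_of_exact (Ideal.mulQuot x J) (Ideal.quotOfMul x J)
    (Ideal.mulQuot_injective J (mem_nonZeroDivisors_of_ne_zero hx))
    (Ideal.quotOfMul_surjective J) (Ideal.exact_mulQuot_quotOfMul J)
  have hcomap : Submodule.comap J.subtype (x • J : Ideal S) = (Ideal.span {x} • ⊤ : Submodule S J) := by
    rw [Submodule.ideal_span_singleton_smul]
    ext z
    rw [Submodule.mem_comap, Submodule.mem_smul_pointwise_iff_exists,
      Submodule.mem_smul_pointwise_iff_exists]
    constructor
    · rintro ⟨w, hw, h⟩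
      exact ⟨⟨w, hw⟩, trivial, Subtype.ext h⟩
    · rintro ⟨w, -, h⟩
      exact ⟨w, w.2, congrArg Subtype.val h⟩
  have hxJ : (x • J : Ideal S) ≤ J := by
    intro z hz
    obtain ⟨w, hw, rfl⟩ := Submodule.mem_smul_pointwise_iff_exists _ _ _ |>.1 hz
    exact J.smul_mem x hw
  have h2 := Module.length_eq_add_of_exact
    (Submodule.mapQ (Ideal.span {x} • ⊤ : Submodule S J) (x • J : Ideal S) J.subtype hcomap.ge)
    (Submodule.factor hxJ)
    (by
      rw [← LinearMap.ker_eq_bot, Submodule.mapQ, Submodule.ker_liftQ_eq_bot']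
      rw [LinearMap.ker_comp, Submodule.ker_mkQ, hcomap])
    (Submodule.factor_surjective _)
    (by
      intro z
      obtain ⟨z, rfl⟩ := Submodule.Quotient.mk_surjective _ z
      constructor
      · intro h
        have hz : z ∈ J := (Submodule.Quotient.mk_eq_zero J).1 h
        exact ⟨Submodule.Quotient.mk ⟨z, hz⟩, rfl⟩
      · rintro ⟨w, hw⟩
        obtain ⟨w, rfl⟩ := Submodule.Quotient.mk_surjective _ w
        rw [← hw]
        exact (Submodule.Quotient.mk_eq_zero J).2 w.2)
  rw [h1, add_comm] at h2
  exact ((ENat.add_left_injective_of_ne_top hfin) h2).ge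

/-- In a one-dimensional Noetherian domain, any family of more than `length (S / x)` elements has a
relation with a coefficient outside a given maximal ideal that contains `x`. -/
lemma exists_sum_mul_eq_zero_of_length_le {S : Type*} [CommRing S] [IsDomain S]
    [IsNoetherianRing S] [Ring.DimensionLEOne S] (p : Ideal S) [p.IsMaximal] {x : S} (hx : x ≠ 0)
    (hxp : x ∈ p) {n : ℕ} (hn : Module.length S (S ⧸ Ideal.span {x}) ≤ n) (g : Fin (n + 1) → S) :
    ∃ c : Fin (n + 1) → S, ∑ i, c i * g i = 0 ∧ ∃ j, c j ∉ p := by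
  let J : Ideal S := Ideal.span (Set.range g)
  let _ : Field (S ⧸ p) := Ideal.Quotient.field p
  let V := J ⧸ (p • ⊤ : Submodule S J)
  -- `J / pJ` is a quotient of `J / xJ`, so the `n + 1` generators are dependent in it.
  have hle : Module.length (S ⧸ p) V ≤ n := by
    rw [← Module.length_eq_of_surjective (S := S) Ideal.Quotient.mk_surjective]
    refine le_trans ?_ ((length_quotient_smul_le hx J).trans hn)
    exact Module.length_le_of_surjective (Submodule.factor (Submodule.smul_mono_left
      ((Ideal.span_singleton_le_iff_mem p).2 hxp))) (Submodule.factor_surjective _)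
  let g' : Fin (n + 1) → J := fun i => ⟨g i, Ideal.subset_span ⟨i, rfl⟩⟩
  have hdep : ¬ LinearIndependent (S ⧸ p) fun i => (Submodule.Quotient.mk (g' i) : V) := by
    intro hli
    have : Module.Finite (S ⧸ p) V := Module.Finite.of_restrictScalars_finite S _ _
    have h := hli.fintype_card_le_finrank
    rw [Module.length_eq_finrank, Nat.cast_le] at hle
    rw [Fintype.card_fin] at h
    exact absurd (h.trans hle) (by omega)
  rw [Fintype.not_linearIndependent_iff] at hdep
  obtain ⟨c', hc', j, hj⟩ := hdep
  choose c hc using fun i => Ideal.Quotient.mk_surjective (c' i)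
  have hmem : ∑ i, c i * g i ∈ p • J := by
    have h : ∑ i, c i • g' i ∈ (p • ⊤ : Submodule S J) := by
      rw [← Submodule.Quotient.mk_eq_zero, ← hc', ← Submodule.mkQ_apply, map_sum]
      refine Finset.sum_congr rfl fun i _ => ?_
      rw [← hc]
      rfl
    have h2 := Submodule.mem_map_of_mem (f := J.subtype) h
    rw [Submodule.map_smul'', Submodule.map_top, Submodule.range_subtype, map_sum] at h2
    exact h2
  -- Subtracting coefficients `d i ∈ p` turns the relation modulo `pJ` into an exact one, without
  -- changing any coefficient modulo `p`.
  obtain ⟨d, hd, hsum⟩ := (Submodule.mem_ideal_smul_span_iff_exists_sum p g _).1 hmem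
  rw [Finsupp.sum_fintype _ _ (by simp)] at hsum
  refine ⟨fun i => c i - d i, ?_, j, fun hcd => hj ?_⟩
  · simp only [sub_mul, Finset.sum_sub_distrib]
    rw [← hsum]
    simp
  · rw [← hc, Ideal.Quotient.eq_zero_iff_mem]
    exact (Submodule.sub_mem_iff_left _ (hd j)).1 hcd

/-- A local, integrally closed domain that is integral over a one-dimensional Noetherian local
domain is a valuation ring. -/
lemma dvd_or_dvd_of_isIntegral (R : Type*) [CommRing R] [IsDomain R] [IsNoetherianRing R]
    [Ring.DimensionLEOne R] {r : R} (hr0 : r ≠ 0) (hr : ¬ IsUnit r)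
    (A : Type*) [CommRing A] [IsDomain A] [IsLocalRing A]
    [IsIntegrallyClosed A] [Algebra R A] [FaithfulSMul R A] [Algebra.IsIntegral R A] (a b : A) :
    a ∣ b ∨ b ∣ a := by
  by_cases ha : a = 0
  · exact Or.inr (ha ▸ dvd_zero b)
  by_cases hb : b = 0
  · exact Or.inl (hb ▸ dvd_zero a)
  let S := Algebra.adjoin R {a, b}
  have : Module.Finite R S := ⟨(Submodule.fg_top _).2 (fg_adjoin_of_finite (Set.toFinite _)
    fun z _ => Algebra.IsIntegral.isIntegral z)⟩
  have : IsNoetherianRing S := IsNoetherianRing.of_finite R S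
  have : Ring.DimensionLEOne S := Ring.DimensionLEOne.of_isIntegral R S
  let a' : S := ⟨a, Algebra.subset_adjoin (by simp)⟩
  let b' : S := ⟨b, Algebra.subset_adjoin (by simp)⟩
  let p : Ideal S := (IsLocalRing.maximalIdeal A).comap S.val
  have : Algebra.IsIntegral S A := Algebra.IsIntegral.tower_top R
  have : p.IsMaximal := Ideal.isMaximal_comap_of_isIntegral_of_isMaximal (R := S)
    (IsLocalRing.maximalIdeal A)
  let x : S := algebraMap R S r
  have hx0 : x ≠ 0 := fun h => hr0 (by
    have h2 : algebraMap R A r = 0 := congrArg Subtype.val h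
    exact (FaithfulSMul.algebraMap_eq_zero_iff R A).1 h2)
  have hxp : x ∈ p := by
    change algebraMap R A r ∈ IsLocalRing.maximalIdeal A
    rw [IsLocalRing.mem_maximalIdeal, mem_nonunits_iff]
    intro h
    have := Algebra.IsIntegral.isLocalHom R A
    exact hr (isUnit_of_map_unit (algebraMap R A) _ h)
  have hfin := Module.length_ne_top_iff.2
    (isFiniteLength_quotient_span_singleton S (mem_nonZeroDivisors_of_ne_zero hx0))
  obtain ⟨n, hn⟩ := ENat.ne_top_iff_exists.1 hfin
  -- There are `n + 1` monomials of degree `n` in `a, b`; dividing their relation by `b ^ n` gives a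
  -- polynomial with root `a / b`. A coefficient outside `p` is a unit of `A`.
  obtain ⟨c, hc, j, hj⟩ := exists_sum_mul_eq_zero_of_length_le p hx0 hxp hn.ge
    fun i => a' ^ (i : ℕ) * b' ^ (n - i)
  let K := FractionRing A
  have hbK : algebraMap A K b ≠ 0 := (map_ne_zero_iff _ (IsFractionRing.injective A K)).2 hb
  have haK : algebraMap A K a ≠ 0 := (map_ne_zero_iff _ (IsFractionRing.injective A K)).2 ha
  let q : Polynomial A := ∑ i : Fin (n + 1), Polynomial.monomial (i : ℕ) (c i : A)
  have hq : Polynomial.aeval (algebraMap A K a / algebraMap A K b) q = 0 := by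
    have h : ∑ i : Fin (n + 1), (c i : A) * (a ^ (i : ℕ) * b ^ (n - i)) = 0 := by
      have := congrArg S.val hc
      simpa only [map_sum, map_mul, map_pow, map_zero] using! this
    have h2 := congrArg (algebraMap A K) h
    rw [map_sum, map_zero] at h2
    refine (mul_eq_zero.1 (?_ : algebraMap A K b ^ n * _ = 0)).resolve_left (pow_ne_zero _ hbK)
    rw [← h2, map_sum, Finset.mul_sum]
    refine Finset.sum_congr rfl fun i _ => ?_
    rw [Polynomial.aeval_monomial, map_mul, map_mul, map_pow, map_pow, div_pow,
      pow_sub₀ _ hbK (Nat.lt_succ_iff.1 i.2), div_eq_mul_inv]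
    ring
  have hcoeff : q.coeff j = c j := by
    simp only [q, Polynomial.finsetSum_coeff, Polynomial.coeff_monomial, Fin.val_inj]
    simp
  obtain ⟨d, hd⟩ | ⟨d, hd⟩ := mem_range_or_inv_mem_range_of_isUnit_coeff _ _ q le_rfl hq
    ⟨j, by rw [hcoeff]; exact not_not.1 hj⟩
  · right
    refine ⟨d, IsFractionRing.injective A K ?_⟩
    rw [map_mul, hd, mul_div_cancel₀ _ hbK]
  · left
    refine ⟨d, IsFractionRing.injective A K ?_⟩
    rw [map_mul, hd, inv_div, mul_div_cancel₀ _ haK]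

end Valuation

/-! ### Integral closedness and roots in `R⁺` -/

section AbsIntClosure

variable (R : Type u) [CommRing R] [IsDomain R]

instance AbsIntClosure.faithfulSMul : FaithfulSMul R (AbsIntClosure R) := by
  rw [faithfulSMul_iff_algebraMap_injective]
  have h : Function.Injective (algebraMap R (AlgebraicClosure (FractionRing R))) := by
    rw [IsScalarTower.algebraMap_eq R (FractionRing R)]
    exact (algebraMap (FractionRing R) _).injective.comp (IsFractionRing.injective R _)
  exact fun a b hab => h (congrArg Subtype.val hab)

instance AbsIntClosure.isIntegrallyClosed : IsIntegrallyClosed (AbsIntClosure R) := by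
  let L := AlgebraicClosure (FractionRing R)
  have : Algebra.IsAlgebraic R L :=
    (IsFractionRing.comap_isAlgebraic_iff (A := R) (K := FractionRing R) (C := L)).2 inferInstance
  have : IsFractionRing (AbsIntClosure R) L :=
    integralClosure.isFractionRing_of_algebraic (A := R) (L := L) fun x hx => by
      have h : algebraMap R (AbsIntClosure R) x = 0 := Subtype.ext hx
      exact (FaithfulSMul.algebraMap_eq_zero_iff R _).1 h
  refine (isIntegrallyClosed_iff L).2 fun {x} hx => ?_
  exact ⟨⟨x, isIntegral_trans (R := R) (A := AbsIntClosure R) x hx⟩, rfl⟩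

variable {R}

lemma AbsIntClosure.exists_pow_eq (x : AbsIntClosure R) {n : ℕ} (hn : 0 < n) :
    ∃ y : AbsIntClosure R, y ^ n = x := by
  obtain ⟨y, hy⟩ := IsAlgClosed.exists_pow_nat_eq (x : AlgebraicClosure (FractionRing R)) hn
  refine ⟨⟨y, IsIntegral.of_pow hn ?_⟩, Subtype.ext hy⟩
  rw [hy]
  exact x.2

end AbsIntClosure

/-! ### Almost zero modules over a one-dimensional valuation ring -/

section RankOne

variable {A : Type u} [CommRing A] [IsDomain A] [IsLocalRing A] [Ring.DimensionLEOne A]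

-- The maximal ideal is the only prime that can contain `x`, so it lies in the radical of `(x)`.
omit [IsDomain A] in
lemma exists_dvd_pow_of_mem_maximalIdeal {x c : A} (hx : x ≠ 0)
    (hc : c ∈ IsLocalRing.maximalIdeal A) : ∃ k, x ∣ c ^ k := by
  have h : c ∈ (Ideal.span {x}).radical := by
    rw [Ideal.radical_eq_sInf, Submodule.mem_sInf]
    rintro P ⟨hP, hprime⟩
    have hP0 : P ≠ ⊥ := by
      rintro rfl
      exact hx (hP (Ideal.mem_span_singleton_self x))
    rwa [IsLocalRing.eq_maximalIdeal (Ideal.IsPrime.isMaximal hprime hP0)]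
  obtain ⟨k, hk⟩ := h
  exact ⟨k, Ideal.mem_span_singleton.1 hk⟩

/-- In a one-dimensional valuation ring the roots of `x` of large order divide any given nonzero
element of the maximal ideal. -/
lemma exists_forall_dvd_of_pow_eq (hdvd : ∀ a b : A, a ∣ b ∨ b ∣ a) {x c : A} (hx : x ≠ 0)
    (hc : c ∈ IsLocalRing.maximalIdeal A) :
    ∃ k, ∀ n, k ≤ n → ∀ y : A, y ^ n = x → y ∣ c := by
  by_cases hc0 : c = 0
  · exact ⟨0, fun _ _ y _ => hc0 ▸ dvd_zero y⟩
  obtain ⟨k, hk⟩ := exists_dvd_pow_of_mem_maximalIdeal hx hc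
  refine ⟨k + 1, fun n hn y hy => (hdvd y c).resolve_right fun h => ?_⟩
  -- If `c ∣ y` then `c ^ n ∣ x ∣ c ^ k` with `n > k`, impossible for a nonzero nonunit.
  have h1 : c ^ n ∣ c ^ k := dvd_trans (hy ▸ pow_dvd_pow_of_dvd h n) hk
  exact absurd ((pow_dvd_pow_iff hc0 hc).1 h1) (by omega)

omit [IsDomain A] [Ring.DimensionLEOne A] in
lemma almostZeroMax_iff (M : ModuleCat.{u} A) :
    AlmostZeroMax A M ↔ ∀ a ∈ IsLocalRing.maximalIdeal A, ∀ m : M, a • m = 0 := by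
  rw [AlmostZeroMax, ← le_bot_iff, Submodule.smul_le]
  simp only [Submodule.mem_top, Submodule.mem_bot, true_implies]

lemma almostZeroMax_eq_almostZeroElt (hdvd : ∀ a b : A, a ∣ b ∨ b ∣ a)
    (hroot : ∀ (x : A) (n : ℕ), 0 < n → ∃ y, y ^ n = x) {x : A} (hx : x ≠ 0)
    (hxm : x ∈ IsLocalRing.maximalIdeal A) : AlmostZeroMax A = AlmostZeroElt x := by
  ext M
  rw [almostZeroMax_iff]
  constructor
  · intro h N
    obtain ⟨y, hy⟩ := hroot x (N + 1) N.succ_pos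
    exact ⟨N + 1, N.le_succ, N.succ_pos, y, hy, h y (Ideal.IsPrime.mem_of_pow_mem inferInstance _
      (hy ▸ hxm))⟩
  · intro h c hc m
    obtain ⟨k, hk⟩ := exists_forall_dvd_of_pow_eq hdvd hx hc
    obtain ⟨n, hn, -, y, hy, hM⟩ := h k
    obtain ⟨d, rfl⟩ := hk n hn y hy
    rw [mul_comm, mul_smul, hM, smul_zero]

section

variable {v : AddValuation A (WithTop ℚ)} (hv : ∀ a, v a = ⊤ → a = 0) (hv0 : ∀ a, 0 ≤ v a)
  (hvm : ∀ a ∈ IsLocalRing.maximalIdeal A, 0 < v a)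

omit [IsDomain A] [IsLocalRing A] [Ring.DimensionLEOne A] in
include hv hv0 in
/-- Roots of high order of an element have small value. -/
lemma exists_pow_eq_and_val_lt (hroot : ∀ (x : A) (n : ℕ), 0 < n → ∃ y, y ^ n = x) {x : A}
    (hx : x ≠ 0) {ε : ℚ} (hε : 0 < ε) :
    ∃ n : ℕ, ∃ y : A, y ^ n = x ∧ v y < (ε : WithTop ℚ) := by
  obtain ⟨q, hq⟩ := WithTop.ne_top_iff_exists.1 (fun h => hx (hv x h))
  obtain ⟨n, hn⟩ := exists_nat_gt (q / ε)
  obtain ⟨y, hy⟩ := hroot x (n + 1) n.succ_pos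
  refine ⟨n + 1, y, hy, ?_⟩
  have hy0 : v y ≠ ⊤ := by
    intro h
    rw [← hy, v.map_pow, h] at hq
    exact WithTop.coe_ne_top (hq.trans (by rw [succ_nsmul, add_top]))
  obtain ⟨r, hr⟩ := WithTop.ne_top_iff_exists.1 hy0
  have hr0 : 0 ≤ r := by
    have := hv0 y
    rw [← hr] at this
    exact_mod_cast this
  rw [← hr, WithTop.coe_lt_coe]
  rw [← hy, v.map_pow, ← hr, ← WithTop.coe_nsmul, WithTop.coe_inj, nsmul_eq_mul] at hq
  rw [div_lt_iff₀ hε, hq] at hn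
  push_cast at hn
  by_contra! h
  nlinarith [mul_le_mul_of_nonneg_left h (Nat.cast_nonneg (α := ℚ) n)]

-- An annihilator of value below `v c` is not a multiple of `c`, hence divides `c`. Conversely,
-- roots of `x` have arbitrarily small value and lie in the maximal ideal.
omit [IsDomain A] [Ring.DimensionLEOne A] in
include hv hv0 hvm in
lemma almostZeroVal_eq_almostZeroMax (hdvd : ∀ a b : A, a ∣ b ∨ b ∣ a)
    (hroot : ∀ (x : A) (n : ℕ), 0 < n → ∃ y, y ^ n = x) {x : A} (hx : x ≠ 0)
    (hxm : x ∈ IsLocalRing.maximalIdeal A) : AlmostZeroVal v = AlmostZeroMax A := by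
  ext M
  rw [almostZeroMax_iff]
  constructor
  · intro h c hc m
    by_cases hc0 : c = 0
    · rw [hc0, zero_smul]
    obtain ⟨q, hq⟩ := WithTop.ne_top_iff_exists.1 (fun h => hc0 (hv c h))
    have hq0 : 0 < q := by
      have := hvm c hc
      rw [← hq] at this
      exact_mod_cast this
    obtain ⟨a, ha, ham⟩ := h m q hq0
    obtain ⟨d, rfl⟩ | ⟨d, rfl⟩ := hdvd a c
    · rw [mul_comm, mul_smul, ham, smul_zero]
    · rw [hq, v.map_mul] at ha
      exact absurd ha (not_lt.2 (le_add_of_nonneg_right (hv0 d)))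
  · intro h m ε hε
    obtain ⟨n, y, hy, hlt⟩ := exists_pow_eq_and_val_lt hv hv0 hroot hx hε
    exact ⟨y, hlt, h y (Ideal.IsPrime.mem_of_pow_mem inferInstance _ (hy ▸ hxm)) m⟩

end

omit [IsDomain A] [Ring.DimensionLEOne A] in
/-- The largest submodule killed by the maximal ideal. -/
lemma mem_torsionPart_iff {T : ObjectProperty (ModuleCat.{u} A)} (hT : T = AlmostZeroMax A)
    (M : ModuleCat.{u} A) (m : M) :
    m ∈ torsionPart T M ↔ ∀ a ∈ IsLocalRing.maximalIdeal A, a • m = 0 := by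
  subst hT
  constructor
  · intro hm a ha
    have hle : torsionPart (AlmostZeroMax A) M ≤ LinearMap.ker (LinearMap.lsmul A M a) :=
      sSup_le fun N hN n hn =>
        congrArg Subtype.val ((almostZeroMax_iff _).1 hN a ha (⟨n, hn⟩ : N))
    exact hle hm
  · intro hm
    have hN : Submodule.span A {m} ≤ torsionPart (AlmostZeroMax A) M := by
      refine le_sSup ((almostZeroMax_iff _).2 fun a ha n => Subtype.ext ?_)
      obtain ⟨b, hb⟩ := Submodule.mem_span_singleton.1 n.2
      change a • (n : M) = 0
      rw [← hb, smul_comm, hm a ha, smul_zero]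
    exact hN (Submodule.mem_span_singleton_self m)

theorem cohomologicalDimensionEq_two_of_eq_almostZeroMax (hdvd : ∀ a b : A, a ∣ b ∨ b ∣ a)
    (hroot : ∀ (x : A) (n : ℕ), 0 < n → ∃ y, y ^ n = x) {x : A} (hx : x ≠ 0)
    (hxm : x ∈ IsLocalRing.maximalIdeal A) (T : ObjectProperty (ModuleCat.{u} A))
    [IsTorsionTheory T] (hT : T = AlmostZeroMax A) : CohomologicalDimensionEq T 2 := by
  -- Iterating one choice of square root gives `t n = t (n + 1) ^ 2` exactly, not just up to a unit,
  -- so `s n = t (n + 1)`.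
  choose r hr using fun a : A => hroot a 2 two_pos
  let t : ℕ → A := fun n => r^[n] x
  have htt : ∀ n, t (n + 1) ^ 2 = t n := fun n => by
    simp only [t, Function.iterate_succ_apply', hr]
  have htx : ∀ n, t n ^ 2 ^ n = x := by
    intro n
    induction n with
    | zero => simp [t]
    | succ n ih => rw [pow_succ', pow_mul, htt, ih]
  have ht0 : ∀ n, t n ≠ 0 := by
    intro n h
    apply hx
    rw [← htx n, h, zero_pow (by positivity)]
  have htm : ∀ n, t n ∈ IsLocalRing.maximalIdeal A := fun n =>
    Ideal.IsPrime.mem_of_pow_mem inferInstance _ ((htx n).symm ▸ hxm)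
  refine cohomologicalDimensionEq_two (s := fun n => t (n + 1)) ht0
    (fun n => by rw [smul_eq_mul, ← sq, htt]) (fun M m => ?_) (fun n => htm (n + 1))
  rw [mem_torsionPart_iff hT]
  refine ⟨fun h n => h _ (htm n), fun h c hc => ?_⟩
  obtain ⟨k, hk⟩ := exists_forall_dvd_of_pow_eq hdvd hx hc
  obtain ⟨d, rfl⟩ := hk (2 ^ k) k.lt_two_pow_self.le (t k) (htx k)
  rw [mul_comm, mul_smul, h, smul_zero]

end RankOne

/-- For a one-dimensional Noetherian complete local domain `R`, the ring `R⁺` is local, and for every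
nonzero `x` in its maximal ideal and every `ℚ`-valued valuation `v` on `R⁺` that is nonnegative on
`R⁺` and positive on the maximal ideal, the three classes of almost zero modules coincide, and the
cohomological dimension of `𝔗_v` is `2`. -/
theorem proposition6p4 (R : Type u) [CommRing R] [IsDomain R] [IsNoetherianRing R] [IsLocalRing R]
    [IsAdicComplete (IsLocalRing.maximalIdeal R) R] (hdim : ringKrullDim R = 1) :
    ∃ _ : IsLocalRing (AbsIntClosure R),
      ∀ x ∈ IsLocalRing.maximalIdeal (AbsIntClosure R), x ≠ 0 →
        AlmostZeroMax (AbsIntClosure R) = AlmostZeroElt x ∧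
        ∀ v : AddValuation (AbsIntClosure R) (WithTop ℚ),
          (∀ a, v a = ⊤ → a = 0) →
          (∀ a, 0 ≤ v a) →
          (∀ a ∈ IsLocalRing.maximalIdeal (AbsIntClosure R), 0 < v a) →
            AlmostZeroVal v = AlmostZeroMax (AbsIntClosure R) ∧
            CohomologicalDimensionEq (AlmostZeroVal v) 2 := by
  have hloc : IsLocalRing (AbsIntClosure R) := IsLocalRing.of_isIntegral_of_isAdicComplete R _
  have hR : Ring.DimensionLEOne R := by
    have h1 : Ring.KrullDimLE 1 R := (Ring.krullDimLE_iff).2 hdim.le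
    exact ⟨fun hP hprime => Ring.krullDimLE_one_iff_of_isPrime_bot.1 h1 _ hP hprime⟩
  have hfield : ¬ IsField R := fun h => by
    rw [ringKrullDim_eq_zero_of_isField h] at hdim
    exact zero_ne_one hdim
  obtain ⟨r, hr0, hr⟩ := Ring.exists_not_isUnit_of_not_isField hfield
  have hdvd : ∀ a b : AbsIntClosure R, a ∣ b ∨ b ∣ a := dvd_or_dvd_of_isIntegral R hr0 hr _
  have hroot : ∀ (x : AbsIntClosure R) (n : ℕ), 0 < n → ∃ y, y ^ n = x := fun x n hn =>
    AbsIntClosure.exists_pow_eq x hn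
  refine ⟨hloc, fun x hx hx0 => ⟨almostZeroMax_eq_almostZeroElt hdvd hroot hx0 hx,
    fun v hv hv0 hvm => ?_⟩⟩
  have hT := almostZeroVal_eq_almostZeroMax hv hv0 hvm hdvd hroot hx0 hx
  exact ⟨hT, cohomologicalDimensionEq_two_of_eq_almostZeroMax hdvd hroot hx0 hx _ hT⟩
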